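/- All graphs have a finite node set $\mathbf V$, no loops and at most one edge, directed ($\to$) or undirected ($-$), between any two nodes. A \emph{PDAG} is such a graph without directed cycles; a \emph{DAG} is a PDAG with only directed edges. A PDAG is \emph{maximal} if its orientations are closed under Meek's four rules, i.e. it has none of the following as an induced subgraph: (R1) $k\to i-j$; (R2) $i\to k\to j$, $i-j$; (R3) $i-j$, $i-k\to j$, $i-l\to j$; (R4) $i-j$, $i-k$, $i-l$, $k\to l\to j$ (pairs not listed are non-adjacent). For a maximal PDAG $G$, $[G]$ is the set of maximal PDAGs $G'$ with the same adjacencies and the same unshielded colliders (triples $a\to b\leftarrow c$ with $a\ne c$ non-adjacent) as $G$ such that every directed edge of $G$ is in $G'$. A path is a sequence of distinct nodes in which successive nodes are adjacent; a path from $\mathbf X$ to $\mathbf Y$ (starting in $\mathbf X$ and ending in $\mathbf Y$) is proper if only its first node is in $\mathbf X$. A path $\langle V_0,\dots,V_k\rangle$, $k\ge1$, is b-possibly causal in $G$ if no edge $V_i\leftarrow V_j$ with $i<j$ is in $G$, and b-non-causal otherwise. A node $W'$ is a b-possible descendant of $W$ if $W'=W$ or there is a b-possibly causal path from $W$ to $W'$.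 A non-endpoint $b$ of a path with neighbours $a,c$ on it is a collider if $a\to b\leftarrow c$; it is a definite non-collider if $b\to a$ or $b\to c$, or if $a-b-c$ with $a,c$ non-adjacent. A path is of definite status if each non-endpoint on it is a collider or a definite non-collider. A definite status path with endpoints outside $\mathbf Z$ is blocked by $\mathbf Z$ unless no definite non-collider on it is in $\mathbf Z$ and every collider on it has a descendant in $\mathbf Z$ (every node being a descendant of itself). \textbf{Lemma.} Let $\mathbf X,\mathbf Y,\mathbf Z$ be pairwise disjoint node sets in a maximal PDAG $G$ such that $[G]$ contains at least one DAG. Suppose that $G$ is b-amenable relative to $(\mathbf X,\mathbf Y)$, i.e. every proper b-possibly causal path from $\mathbf X$ to $\mathbf Y$ in $G$ starts with a directed edge out of $\mathbf X$; and that $\mathbf Z$ satisfies the b-forbidden set condition in $G$, i.e. $\mathbf Z$ contains no b-possible descendant of any node $W\notin\mathbf X$ that lies on a proper b-possibly causal path from $\mathbf X$ to $\mathbf Y$ in $G$. For a graph $H$, say that $\mathbf Z$ satisfies the b-blocking condition relative to $(\mathbf X,\mathbf Y)$ in $H$ if every proper b-non-causal definite status path from $\mathbf X$ to $\mathbf Y$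 in $H$ is blocked by $\mathbf Z$ in $H$. Then the following are equivalent: (i) $\mathbf Z$ satisfies the b-blocking condition relative to $(\mathbf X,\mathbf Y)$ in $G$; (ii) $\mathbf Z$ satisfies the b-blocking condition relative to $(\mathbf X,\mathbf Y)$ in every DAG in $[G]$; (iii) $\mathbf Z$ satisfies the b-blocking condition relative to $(\mathbf X,\mathbf Y)$ in some DAG in $[G]$. -/

import Mathlib

/-- A partially directed graph on the node set `V`: `dir a b` means `a → b`, `undir a b` means
`a - b`. There are no loops and there is at most one edge between any two nodes. -/
structure PartiallyDirectedGraph (V : Type*) where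
  dir : V → V → Prop
  undir : V → V → Prop
  undir_symm : ∀ a b, undir a b → undir b a
  undir_irrefl : ∀ a, ¬ undir a a
  dir_asymm : ∀ a b, dir a b → ¬ dir b a
  not_undir_of_dir : ∀ a b, dir a b → ¬ undir a b

namespace PartiallyDirectedGraph

variable {V : Type*}

/-- Two nodes are adjacent if some edge connects them. -/
def Adj (G : PartiallyDirectedGraph V) (a b : V) : Prop :=
  G.dir a b ∨ G.dir b a ∨ G.undir a b

/-- A PDAG is a partially directed graph without directed cycles. -/
def IsPDAG (G : PartiallyDirectedGraph V) : Prop :=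
  ∀ a, ¬ Relation.TransGen G.dir a a

/-- A DAG has only directed edges and no directed cycles. -/
def IsDAG (G : PartiallyDirectedGraph V) : Prop :=
  (∀ a b, ¬ G.undir a b) ∧ G.IsPDAG

/-- `b` is a descendant of `a`: `a = b` or there is a directed path from `a` to `b`. -/
def IsDescendant (G : PartiallyDirectedGraph V) (a b : V) : Prop :=
  Relation.ReflTransGen G.dir a b

/-- `a → b ← c` with `a` and `c` distinct and not adjacent. -/
def UnshieldedCollider (G : PartiallyDirectedGraph V) (a b c : V) : Prop :=
  G.dir a b ∧ G.dir c b ∧ a ≠ c ∧ ¬ G.Adj a c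

/-! The left-hand sides of Meek's four orientation rules, as induced subgraphs; the undirected
edge `i - j` is the one the rule would orient as `i → j`. -/

/-- R1: `k → i - j`, with `k` and `j` not adjacent. -/
def MeekR1 (G : PartiallyDirectedGraph V) (i j k : V) : Prop :=
  G.undir i j ∧ G.dir k i ∧ ¬ G.Adj k j

/-- R2: `i → k → j` and `i - j`. -/
def MeekR2 (G : PartiallyDirectedGraph V) (i j k : V) : Prop :=
  G.undir i j ∧ G.dir i k ∧ G.dir k j

/-- R3: `i - k → j`, `i - l → j` and `i - j`, with `k` and `l` distinct and not adjacent. -/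
def MeekR3 (G : PartiallyDirectedGraph V) (i j k l : V) : Prop :=
  G.undir i j ∧ G.undir i k ∧ G.undir i l ∧ G.dir k j ∧ G.dir l j ∧ k ≠ l ∧ ¬ G.Adj k l

/-- R4: `k → l → j`, `i - k`, `i - l` and `i - j`, with `k` and `j` not adjacent. -/
def MeekR4 (G : PartiallyDirectedGraph V) (i j k l : V) : Prop :=
  G.undir i j ∧ G.undir i k ∧ G.undir i l ∧ G.dir k l ∧ G.dir l j ∧ ¬ G.Adj k j

/-- A maximal PDAG: a PDAG whose orientations are closed under R1-R4, that is, none of the rules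
has an undirected edge left to orient. -/
def IsMaximalPDAG (G : PartiallyDirectedGraph V) : Prop :=
  G.IsPDAG ∧ (∀ i j k, ¬ G.MeekR1 i j k) ∧ (∀ i j k, ¬ G.MeekR2 i j k) ∧
    (∀ i j k l, ¬ G.MeekR3 i j k l) ∧ (∀ i j k l, ¬ G.MeekR4 i j k l)

/-- `G` represents `G'`: same adjacencies, same unshielded colliders, and every directed edge of
`G` is in `G'`. -/
def Represents (G G' : PartiallyDirectedGraph V) : Prop :=
  (∀ a b, G'.Adj a b ↔ G.Adj a b) ∧
    (∀ a b c, G'.UnshieldedCollider a b c ↔ G.UnshieldedCollider a b c) ∧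
    (∀ a b, G.dir a b → G'.dir a b)

/-- `[G]`, the set of all maximal PDAGs represented by `G`. -/
def representedClass (G : PartiallyDirectedGraph V) : Set (PartiallyDirectedGraph V) :=
  {G' | G'.IsMaximalPDAG ∧ G.Represents G'}

/-- `p` is a path from `x` to `y`: a sequence of distinct nodes, successive ones adjacent. -/
def IsPath (G : PartiallyDirectedGraph V) (x y : V) (p : List V) : Prop :=
  p.head? = some x ∧ p.getLast? = some y ∧ p.Nodup ∧ p.IsChain G.Adj

/-- `p` is a proper path from the node set `X` to the node set `Y`: only its first node is
in `X`. -/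
def IsProperPath (G : PartiallyDirectedGraph V) (X Y : Set V) (p : List V) : Prop :=
  (∃ x ∈ X, ∃ y ∈ Y, G.IsPath x y p) ∧ ∀ v ∈ p.tail, v ∉ X

/-- The path `p = ⟨V₀, …, V_k⟩`, `k ≥ 1`, is b-possibly causal if no edge `V_i ← V_j` with
`i < j` is in `G`, whether on `p` or not. -/
def BPossiblyCausal (G : PartiallyDirectedGraph V) (p : List V) : Prop :=
  2 ≤ p.length ∧ p.Pairwise (fun a b => ¬ G.dir b a)

/-- The path `p`, with at least one edge, is b-non-causal if it is not b-possibly causal. -/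
def BNonCausal (G : PartiallyDirectedGraph V) (p : List V) : Prop :=
  2 ≤ p.length ∧ ¬ G.BPossiblyCausal p

/-- The b-possible descendants of the node set `S`. -/
def bPossDe (G : PartiallyDirectedGraph V) (S : Set V) : Set V :=
  {w | w ∈ S ∨ ∃ x ∈ S, ∃ p, G.IsPath x w p ∧ G.BPossiblyCausal p}

/-- The non-endpoint `b`, with neighbours `a` and `c` on a path, is a collider on it. -/
def IsCollider (G : PartiallyDirectedGraph V) (a b c : V) : Prop :=
  G.dir a b ∧ G.dir c b

/-- The non-endpoint `b`, with neighbours `a` and `c` on a path, is a definite non-collider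
on it. -/
def IsDefiniteNonCollider (G : PartiallyDirectedGraph V) (a b c : V) : Prop :=
  G.dir b a ∨ G.dir b c ∨ (G.undir a b ∧ G.undir b c ∧ ¬ G.Adj a c)

/-- The path `p` is of definite status: each of its non-endpoints is a collider or a definite
non-collider. -/
def DefiniteStatus (G : PartiallyDirectedGraph V) (p : List V) : Prop :=
  ∀ a b c, [a, b, c] <:+: p → G.IsCollider a b c ∨ G.IsDefiniteNonCollider a b c

/-- The definite status path `p`, whose endpoints are not in `Z`, is d-connecting given `Z`. -/
def DConnecting (G : PartiallyDirectedGraph V) (Z : Set V) (p : List V) : Prop :=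
  ∀ a b c, [a, b, c] <:+: p →
    (G.IsDefiniteNonCollider a b c → b ∉ Z) ∧
    (G.IsCollider a b c → ∃ z ∈ Z, G.IsDescendant b z)

/-- The definite status path `p`, whose endpoints are not in `Z`, is blocked by `Z`. -/
def Blocked (G : PartiallyDirectedGraph V) (Z : Set V) (p : List V) : Prop :=
  ¬ G.DConnecting Z p

/-- `G` is b-amenable relative to `(X, Y)`: every proper b-possibly causal path from `X` to `Y`
starts with a directed edge out of `X`. -/
def BAmenable (G : PartiallyDirectedGraph V) (X Y : Set V) : Prop :=
  ∀ p, G.IsProperPath X Y p → G.BPossiblyCausal p → ∃ a b l, p = a :: b :: l ∧ G.dir a b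

/-- The b-forbidden set relative to `(X, Y)`. -/
def bForb (G : PartiallyDirectedGraph V) (X Y : Set V) : Set V :=
  {w' | ∃ w, w ∉ X ∧ (∃ p, G.IsProperPath X Y p ∧ G.BPossiblyCausal p ∧ w ∈ p) ∧
    w' ∈ G.bPossDe {w}}

/-- The b-forbidden set condition: `Z` contains no b-forbidden node. -/
def BForbiddenSetCondition (G : PartiallyDirectedGraph V) (X Y Z : Set V) : Prop :=
  Z ∩ G.bForb X Y = ∅

/-- The b-blocking condition: all proper b-non-causal definite status paths from `X` to `Y` are
blocked by `Z`. -/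
def BBlockingCondition (G : PartiallyDirectedGraph V) (X Y Z : Set V) : Prop :=
  ∀ p, G.IsProperPath X Y p → G.BNonCausal p → G.DefiniteStatus p → G.Blocked Z p

end PartiallyDirectedGraph

/-! From (iii) to (i), an open violating path of `G` is carried to the DAG `D` unchanged:
orientations persist, definite statuses keep their type, and descendants remain descendants
(`Represents.bBlockingCondition`).

From (i) to (ii), suppose that some DAG `D` in `[G]` has a proper open path that is not directed.
Take one that minimises the pair (length, sum over its nodes of the number of proper descendants in
`D`) lexicographically. Every shorter proper open path is then directed in `D`, hence b-possibly
causal in `G`, so by the forbidden set condition its nodes outside `X` are not ancestors of `Z`;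
this is `ShorterCausal`. The minimal path violates blocking in `G` itself: - it is b-non-causal in
`G`, by amenability and the forbidden set condition (`Represents.bNonCausal`); - it has definite
status in `G`, since otherwise a node could be skipped (`ShorterCausal.definiteStatus`); - each
collider has a descendant in `Z` already in `G`, since otherwise the collider could be moved down to
a child, lowering the descendant sum or shortening the path (`ShorterCausal.dir_of_isCollider`,
`Represents.exists_isDescendant`). -/

namespace PartiallyDirectedGraph

variable {V : Type*} {G D : PartiallyDirectedGraph V} {X Y Z : Set V}

/-! ### Lists and their consecutive triples -/

theorem triple_infix_split {x y z a c : V} {l r : List V}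
    (h : [x, y, z] <:+: l ++ a :: c :: r) :
    [x, y, z] <:+: l ++ [a, c] ∨ [x, y, z] <:+: a :: c :: r := by
  induction l with
  | nil => exact Or.inr h
  | cons u l ih =>
    rw [List.cons_append, List.infix_cons_iff] at h
    rcases h with h | h
    · left
      rw [List.cons_append, List.infix_cons_iff]
      left
      rcases l with _ | ⟨v, _ | ⟨w, l⟩⟩ <;> simp_all
    · rcases ih h with h | h
      · exact Or.inl (h.trans (List.suffix_cons _ _).isInfix)
      · exact Or.inr h

/-- The middle node `b` of `a, b, c` does not block a path through these nodes. -/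
def OpenTriple (D : PartiallyDirectedGraph V) (Z : Set V) (a b c : V) : Prop :=
  (D.IsDefiniteNonCollider a b c → b ∉ Z) ∧
    (D.IsCollider a b c → ∃ z ∈ Z, D.IsDescendant b z)

theorem DConnecting.of_infix {p q : List V} (h : D.DConnecting Z p) (hq : q <:+: p) :
    D.DConnecting Z q :=
  fun a b c habc => h a b c (habc.trans hq)

theorem DConnecting.openTriple {l r : List V} {a b c : V}
    (h : D.DConnecting Z (l ++ a :: b :: c :: r)) : D.OpenTriple Z a b c :=
  h a b c ⟨l, r, by simp⟩

theorem dConnecting_split {l r : List V} {a c : V} :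
    D.DConnecting Z (l ++ a :: c :: r) ↔
      D.DConnecting Z (l ++ [a, c]) ∧ D.DConnecting Z (a :: c :: r) := by
  constructor
  · intro h
    exact ⟨h.of_infix ⟨[], r, by simp⟩, h.of_infix ⟨l, [], by simp⟩⟩
  · rintro ⟨h₁, h₂⟩ x y z h
    exact (triple_infix_split h).elim (h₁ x y z) (h₂ x y z)

theorem dConnecting_pair (a b : V) : D.DConnecting Z [a, b] := by
  intro x y z h
  simpa using h.length_le

/-- Only the triple centred at `a` sees the last node. With `DConnecting.change_head`, this reduces
openness of a shortcut to a check at the two ends of its new edge. -/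
theorem DConnecting.change_last {l : List V} {a b c : V} (h : D.DConnecting Z (l ++ [a, b]))
    (hs : ∀ u, D.OpenTriple Z u a b → D.OpenTriple Z u a c) : D.DConnecting Z (l ++ [a, c]) := by
  rcases List.eq_nil_or_concat l with rfl | ⟨l', u, rfl⟩
  · exact dConnecting_pair a c
  · have h₁ : D.DConnecting Z (l' ++ u :: a :: [b]) := by simpa using h
    have h₂ : D.DConnecting Z (l' ++ u :: a :: [c]) := by
      rw [dConnecting_split]
      refine ⟨(dConnecting_split.1 h₁).1, ?_⟩
      intro x y z hx
      have := hx.eq_of_length (by simp)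
      simp only [List.cons.injEq, and_true] at this
      obtain ⟨rfl, rfl, rfl⟩ := this
      exact hs _ (DConnecting.openTriple (r := []) h₁)
    simpa using h₂

theorem DConnecting.change_head {r : List V} {a b c : V} (h : D.DConnecting Z (b :: c :: r))
    (hs : ∀ u, D.OpenTriple Z b c u → D.OpenTriple Z a c u) : D.DConnecting Z (a :: c :: r) := by
  rcases r with _ | ⟨u, r⟩
  · exact dConnecting_pair a c
  · have : D.DConnecting Z ([a] ++ c :: u :: r) := by
      rw [dConnecting_split]
      refine ⟨?_, h.of_infix ⟨[b], [], by simp⟩⟩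
      intro x y z hx
      have := hx.eq_of_length (by simp)
      simp only [List.singleton_append, List.cons.injEq, and_true] at this
      obtain ⟨rfl, rfl, rfl⟩ := this
      exact hs _ (DConnecting.openTriple (l := []) h)
    simpa using this

/-! ### Modifying proper paths -/

theorem Adj.symm {a b : V} (h : D.Adj a b) : D.Adj b a := by
  rcases h with h | h | h
  · exact Or.inr (Or.inl h)
  · exact Or.inl h
  · exact Or.inr (Or.inr (D.undir_symm _ _ h))

theorem isProperPath_iff {p : List V} :
    D.IsProperPath X Y p ↔ (∃ x ∈ X, p.head? = some x) ∧ (∃ y ∈ Y, p.getLast? = some y) ∧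
      p.Nodup ∧ p.IsChain D.Adj ∧ ∀ v ∈ p.tail, v ∉ X := by
  unfold IsProperPath IsPath
  aesop

theorem isProperPath_append_iff {l r : List V} {a c : V} :
    D.IsProperPath X Y (l ++ a :: c :: r) ↔ (∃ x ∈ X, (l ++ [a]).head? = some x) ∧
      (∃ y ∈ Y, (c :: r).getLast? = some y) ∧ (l ++ a :: c :: r).Nodup ∧
      (l ++ [a]).IsChain D.Adj ∧ (c :: r).IsChain D.Adj ∧ D.Adj a c ∧
      (∀ v ∈ (l ++ [a]).tail, v ∉ X) ∧ ∀ v ∈ c :: r, v ∉ X := by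
  rw [isProperPath_iff]
  have h₁ : (l ++ a :: c :: r).head? = (l ++ [a]).head? := by cases l <;> simp
  have h₂ : (l ++ a :: c :: r).getLast? = (c :: r).getLast? := by
    rw [List.getLast?_append_cons, List.getLast?_cons_cons]
  have h₃ : (l ++ a :: c :: r).tail = (l ++ [a]).tail ++ c :: r := by cases l <;> simp
  have h₄ : (l ++ a :: c :: r).IsChain D.Adj ↔
      (l ++ [a]).IsChain D.Adj ∧ (c :: r).IsChain D.Adj ∧ D.Adj a c := by
    rw [List.isChain_append_cons_cons]
    tauto
  rw [h₁, h₂, h₃, h₄]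
  simp only [List.mem_append, or_imp, forall_and]
  tauto

theorem IsProperPath.shortcut {l m r : List V} {a c : V}
    (h : D.IsProperPath X Y (l ++ a :: (m ++ c :: r))) (hac : D.Adj a c) :
    D.IsProperPath X Y (l ++ a :: c :: r) := by
  have hs : List.Sublist (l ++ a :: c :: r) (l ++ a :: (m ++ c :: r)) := by simp
  rcases m with _ | ⟨b, m⟩
  · exact h
  · rw [List.cons_append, isProperPath_append_iff] at h
    rw [isProperPath_append_iff]
    obtain ⟨h₁, h₂, h₃, h₄, h₅, -, h₇, h₈⟩ := h
    have hsuf : c :: r <:+ b :: (m ++ c :: r) := ⟨b :: m, by simp⟩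
    refine ⟨h₁, ?_, h₃.sublist hs, h₄, h₅.suffix hsuf, hac, h₇, fun v hv => h₈ v (hsuf.mem hv)⟩
    have : (b :: (m ++ c :: r)).getLast? = (c :: r).getLast? := by
      rw [← List.cons_append, List.getLast?_append_cons]
    rwa [this] at h₂

theorem IsProperPath.restart {l r : List V} {a c w : V}
    (h : D.IsProperPath X Y (l ++ a :: c :: r)) (hw : w ∈ X) (hwc : D.Adj w c) :
    D.IsProperPath X Y (w :: c :: r) := by
  rw [isProperPath_append_iff] at h
  obtain ⟨-, h₂, h₃, -, h₅, -, -, h₈⟩ := h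
  refine (isProperPath_append_iff (l := [])).2
    ⟨⟨w, hw, rfl⟩, h₂, ?_, by simp, h₅, hwc, by simp, h₈⟩
  rw [List.nil_append, List.nodup_cons]
  refine ⟨fun hm => h₈ w hm hw, h₃.sublist ?_⟩
  exact (List.sublist_cons_self a _).trans (List.sublist_append_right l _)

theorem IsProperPath.replace {l r : List V} {a b c w : V}
    (h : D.IsProperPath X Y (l ++ a :: b :: c :: r)) (hw : w ∉ X)
    (hwp : w ∉ l ++ a :: b :: c :: r) (haw : D.Adj a w) (hwc : D.Adj w c) :
    D.IsProperPath X Y (l ++ a :: w :: c :: r) := by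
  rw [isProperPath_append_iff] at h ⊢
  obtain ⟨h₁, h₂, h₃, h₄, h₅, -, h₇, h₈⟩ := h
  rw [List.isChain_cons_cons] at h₅
  refine ⟨h₁, by simpa using h₂, ?_, h₄, List.isChain_cons_cons.2 ⟨hwc, h₅.2⟩, haw, h₇, ?_⟩
  · simp only [List.nodup_append, List.nodup_cons, List.mem_cons, List.mem_append] at h₃ hwp ⊢
    grind
  · intro v hv
    rcases List.mem_cons.1 hv with rfl | hv
    · exact hw
    · exact h₈ v (List.mem_cons_of_mem _ hv)

/-! ### Causal paths in DAGs -/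

theorem IsDAG.adj_iff (hD : D.IsDAG) {a b : V} : D.Adj a b ↔ D.dir a b ∨ D.dir b a := by
  simp [Adj, hD.1 a b]

theorem IsDAG.dir_of_adj_of_dir_dir (hD : D.IsDAG) {a b c : V} (hab : D.dir a b)
    (hbc : D.dir b c) (hac : D.Adj a c) : D.dir a c :=
  (hD.adj_iff.1 hac).resolve_right fun h =>
    hD.2 a (((Relation.TransGen.single hab).tail hbc).tail h)

theorem IsPDAG.pairwise_not_dir_of_isChain_dir (hD : D.IsPDAG) {p : List V}
    (hp : p.IsChain D.dir) : p.Pairwise fun a b => ¬ D.dir b a := by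
  have h : p.Pairwise (Relation.TransGen D.dir) :=
    List.isChain_iff_pairwise.1 (hp.imp fun _ _ => Relation.TransGen.single)
  refine h.imp ?_
  intro a b hab hba
  exact hD a (hab.tail hba)

theorem IsDAG.bNonCausal_iff (hD : D.IsDAG) {p : List V} (hp : p.IsChain D.Adj) :
    D.BNonCausal p ↔ 2 ≤ p.length ∧ ¬ p.IsChain D.dir := by
  unfold BNonCausal BPossiblyCausal
  constructor
  · rintro ⟨h2, h⟩
    exact ⟨h2, fun hc => h ⟨h2, hD.2.pairwise_not_dir_of_isChain_dir hc⟩⟩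
  · rintro ⟨h2, h⟩
    refine ⟨h2, fun hc => h ?_⟩
    rw [List.isChain_iff_forall_rel_of_append_cons_cons] at hp ⊢
    intro a b l r hl
    refine (hD.adj_iff.1 (hp hl)).resolve_right ?_
    have := hc.2.isChain
    rw [List.isChain_iff_forall_rel_of_append_cons_cons] at this
    exact this hl

theorem IsDAG.openTriple_iff (hD : D.IsDAG) {a b c : V} :
    D.OpenTriple Z a b c ↔ (D.dir b a ∨ D.dir b c → b ∉ Z) ∧
      (D.dir a b ∧ D.dir c b → ∃ z ∈ Z, D.IsDescendant b z) := by
  simp [OpenTriple, IsDefiniteNonCollider, IsCollider, hD.1]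

theorem exists_collider_of_not_isChain_dir (hD : D.IsDAG) {a b : V} {l : List V}
    (hadj : (a :: b :: l).IsChain D.Adj) (hab : D.dir a b) (hl : ¬ (a :: b :: l).IsChain D.dir) :
    ∃ u v w, [u, v, w] <:+: a :: b :: l ∧ D.IsCollider u v w := by
  induction l generalizing a b with
  | nil => exact absurd (List.isChain_pair.2 hab) hl
  | cons c l ih =>
    rw [List.isChain_cons_cons] at hadj hl
    rcases hD.adj_iff.1 (List.isChain_cons_cons.1 hadj.2).1 with hbc | hcb
    · obtain ⟨u, v, w, h, hc⟩ := ih hadj.2 hbc fun h => hl ⟨hab, h⟩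
      exact ⟨u, v, w, h.trans (List.suffix_cons _ _).isInfix, hc⟩
    · exact ⟨a, b, c, ⟨[], l, rfl⟩, hab, hcb⟩

theorem mem_tail_of_triple_infix {a b c : V} {p : List V} (h : [a, b, c] <:+: p) :
    b ∈ p.tail := by
  obtain ⟨s, t, rfl⟩ := h
  cases s <;> simp

/-! ### Comparing a graph with a represented DAG -/

theorem Represents.isProperPath_congr (h : G.Represents D) {p : List V} :
    D.IsProperPath X Y p ↔ G.IsProperPath X Y p := by
  have : D.Adj = G.Adj := by
    ext a b
    exact h.1 a b
  unfold IsProperPath IsPath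
  rw [this]

/-- A backward edge of `G` along a directed path of `D` would also lie in `D` and close a cycle
there. -/
theorem Represents.mem_bPossDe (h : G.Represents D) (hD : D.IsDAG) {v z : V}
    (hvz : D.IsDescendant v z) : z ∈ G.bPossDe {v} := by
  obtain ⟨l, hl, hz⟩ := List.exists_isChain_cons_of_relationReflTransGen hvz
  rcases l with _ | ⟨u, l⟩
  · exact Or.inl hz.symm
  · right
    have hpw : (v :: u :: l).Pairwise (Relation.TransGen D.dir) :=
      List.isChain_iff_pairwise.1 (hl.imp fun _ _ => Relation.TransGen.single)
    refine ⟨v, rfl, v :: u :: l, ⟨rfl, ?_, ?_, ?_⟩, by simp, ?_⟩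
    · rw [List.getLast?_eq_some_getLast (List.cons_ne_nil _ _), hz]
    · refine hpw.imp ?_
      rintro a _ hab rfl
      exact hD.2 a hab
    · exact hl.imp fun a b hab => (h.1 a b).1 (Or.inl hab)
    · exact (hD.2.pairwise_not_dir_of_isChain_dir hl).imp fun {a b} hab hba => hab (h.2.2 _ _ hba)

theorem Represents.not_isDescendant_of_bPossiblyCausal (h : G.Represents D) (hD : D.IsDAG)
    (hforb : G.BForbiddenSetCondition X Y Z) {p : List V} (hp : D.IsProperPath X Y p)
    (hc : G.BPossiblyCausal p) {v z : V} (hv : v ∈ p.tail) (hz : z ∈ Z) :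
    ¬ D.IsDescendant v z := by
  intro hvz
  have : z ∈ Z ∩ G.bForb X Y :=
    ⟨hz, v, hp.2 v hv, ⟨p, h.isProperPath_congr.1 hp, hc, List.mem_of_mem_tail hv⟩,
      h.mem_bPossDe hD hvz⟩
  rw [hforb] at this
  exact this

theorem Represents.bPossiblyCausal_of_isChain_dir (h : G.Represents D) (hD : D.IsDAG) {p : List V}
    (h2 : 2 ≤ p.length) (hp : p.IsChain D.dir) : G.BPossiblyCausal p :=
  ⟨h2, (hD.2.pairwise_not_dir_of_isChain_dir hp).imp fun {_ _} hab hba => hab (h.2.2 _ _ hba)⟩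

/-- If the path were b-possibly causal in `G`, amenability would make it start out of `X`. Not being
directed in `D`, it would then have a collider there, which is open only through a forbidden node of
`Z`. -/
theorem Represents.bNonCausal (h : G.Represents D) (hD : D.IsDAG) (hamen : G.BAmenable X Y)
    (hforb : G.BForbiddenSetCondition X Y Z) {p : List V} (hp : D.IsProperPath X Y p)
    (hnc : D.BNonCausal p) (hconn : D.DConnecting Z p) : G.BNonCausal p := by
  have hadj : p.IsChain D.Adj := by
    obtain ⟨⟨_, _, _, _, hp⟩, _⟩ := hp
    exact hp.2.2.2
  refine ⟨hnc.1, fun hpc => ?_⟩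
  rw [hD.bNonCausal_iff hadj] at hnc
  obtain ⟨a, b, l, rfl, hab⟩ := hamen p (h.isProperPath_congr.1 hp) hpc
  obtain ⟨u, v, w, huvw, hcol⟩ := exists_collider_of_not_isChain_dir hD hadj (h.2.2 _ _ hab) hnc.2
  obtain ⟨z, hz, hvz⟩ := (hconn u v w huvw).2 hcol
  exact h.not_isDescendant_of_bPossiblyCausal hD hforb hp hpc (mem_tail_of_triple_infix huvw) hz hvz

/-- Directed edges persist in `D`, and an unshielded `a - b - c` cannot become a collider because
`D` has no new unshielded colliders. -/
theorem Represents.isCollider_iff (h : G.Represents D) {a b c : V} (hac : a ≠ c)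
    (hs : G.IsCollider a b c ∨ G.IsDefiniteNonCollider a b c) :
    (D.IsCollider a b c ↔ G.IsCollider a b c) ∧
      (G.IsCollider a b c → ¬ G.IsDefiniteNonCollider a b c) := by
  obtain ⟨hadj, huc, hdir⟩ := h
  have h₁ := hdir a b
  have h₂ := hdir b a
  have h₃ := hdir b c
  have h₄ := hdir c b
  have h₅ := huc a b c
  have h₆ := D.dir_asymm a b
  have h₇ := D.dir_asymm c b
  have h₈ := G.dir_asymm a b
  have h₉ := G.dir_asymm c b
  have h₁₀ := G.not_undir_of_dir a b
  have h₁₁ := hadj a c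
  clear huc hdir hadj
  simp only [IsCollider, IsDefiniteNonCollider, UnshieldedCollider] at *
  grind

theorem IsDAG.definiteStatus_of_isChain (hD : D.IsDAG) {p : List V} (hp : p.IsChain D.Adj) :
    D.DefiniteStatus p := by
  intro a b c habc
  have h := hp.infix habc
  simp only [List.isChain_cons_cons, hD.adj_iff] at h
  unfold IsCollider IsDefiniteNonCollider
  tauto

theorem ne_of_triple_infix {a b c : V} {p : List V} (hp : p.Nodup) (h : [a, b, c] <:+: p) :
    a ≠ c := by
  have := hp.sublist h.sublist
  simp only [List.nodup_cons, List.mem_cons] at this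
  tauto

theorem Represents.bBlockingCondition (h : G.Represents D) (hD : D.IsDAG)
    (hb : D.BBlockingCondition X Y Z) : G.BBlockingCondition X Y Z := by
  intro p hp hnc hds hconn
  have hpD := h.isProperPath_congr.2 hp
  obtain ⟨-, -, hnodup, hadj, -⟩ := isProperPath_iff.1 hpD
  refine hb p hpD ⟨hnc.1, fun hc => hnc.2 ⟨hc.1, hc.2.imp fun {_ _} hab hba => hab (h.2.2 _ _ hba)⟩⟩
    (hD.definiteStatus_of_isChain hadj) ?_
  intro a b c habc
  have hac := ne_of_triple_infix hnodup habc
  have hs := hds a b c habc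
  have hcol := h.isCollider_iff hac hs
  have hcon := hconn a b c habc
  have hexcl : D.IsDefiniteNonCollider a b c → ¬ D.IsCollider a b c := by
    have h₁ := D.dir_asymm a b
    have h₂ := D.dir_asymm c b
    have h₃ := hD.1
    unfold IsCollider IsDefiniteNonCollider
    tauto
  constructor
  · intro hn
    have := hexcl hn
    tauto
  · intro hc
    obtain ⟨z, hz, hbz⟩ := hcon.2 (hcol.1.1 hc)
    exact ⟨z, hz, Relation.ReflTransGen.mono (fun a b => h.2.2 a b) _ _ hbz⟩

/-! ### Shortest open non-causal paths -/

/-- Every proper path that is d-connecting given `Z` and has fewer than `n` nodes is directed, and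
none of its nodes outside `X` has a descendant in `Z`. -/
def ShorterCausal (D : PartiallyDirectedGraph V) (X Y Z : Set V) (n : ℕ) : Prop :=
  ∀ q, D.IsProperPath X Y q → D.DConnecting Z q → 2 ≤ q.length → q.length < n →
    q.IsChain D.dir ∧ ∀ v ∈ q.tail, ∀ z ∈ Z, ¬ D.IsDescendant v z

/-- Jumping from `a` to a later node `c`, whose predecessor is `e`, disturbs only the triples
centred at `a` and `c`; `ha` and `hc` say that these stay open. -/
theorem ShorterCausal.shortcut {l s t r : List V} {a b c e : V}
    (hs : D.ShorterCausal X Y Z (l ++ a :: b :: t).length)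
    (hp : D.IsProperPath X Y (l ++ a :: b :: t)) (hconn : D.DConnecting Z (l ++ a :: b :: t))
    (ht : b :: t = s ++ e :: c :: r) (hac : D.Adj a c)
    (ha : ∀ u, D.OpenTriple Z u a b → D.OpenTriple Z u a c)
    (hc : ∀ u, D.OpenTriple Z e c u → D.OpenTriple Z a c u) :
    (l ++ [a]).IsChain D.dir ∧ D.dir a c ∧ (c :: r).IsChain D.dir ∧
      ∀ v ∈ (l ++ [a]).tail ++ c :: r, ∀ z ∈ Z, ¬ D.IsDescendant v z := by
  have hp' : D.IsProperPath X Y (l ++ a :: c :: r) :=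
    IsProperPath.shortcut (m := s ++ [e]) (by simpa [ht] using hp) hac
  have hconn' : D.DConnecting Z (l ++ a :: c :: r) := by
    rw [dConnecting_split]
    exact ⟨((dConnecting_split.1 hconn).1).change_last ha,
      (hconn.of_infix ⟨l ++ a :: s, [], by simp [ht]⟩).change_head hc⟩
  obtain ⟨h₁, h₂⟩ := hs _ hp' hconn' (by simp; omega) (by simp [ht])
  rw [List.isChain_append_cons_cons] at h₁
  have htail : (l ++ a :: c :: r).tail = (l ++ [a]).tail ++ c :: r := by cases l <;> simp
  rw [htail] at h₂
  exact ⟨h₁.1, h₁.2.1, h₁.2.2, h₂⟩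

theorem ShorterCausal.skip {l r : List V} {a b c : V}
    (hs : D.ShorterCausal X Y Z (l ++ a :: b :: c :: r).length)
    (hp : D.IsProperPath X Y (l ++ a :: b :: c :: r))
    (hconn : D.DConnecting Z (l ++ a :: b :: c :: r)) (hac : D.Adj a c)
    (ha : ∀ u, D.OpenTriple Z u a b → D.OpenTriple Z u a c)
    (hc : ∀ u, D.OpenTriple Z b c u → D.OpenTriple Z a c u) :
    (l ++ [a]).IsChain D.dir ∧ D.dir a c ∧ (c :: r).IsChain D.dir ∧
      ∀ v ∈ (l ++ [a]).tail ++ c :: r, ∀ z ∈ Z, ¬ D.IsDescendant v z :=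
  hs.shortcut (s := []) hp hconn rfl hac ha hc

theorem IsDescendant.head {a b z : V} (hab : D.dir a b) (h : D.IsDescendant b z) :
    D.IsDescendant a z :=
  Relation.ReflTransGen.head hab h

/-- A collider on a shortest open non-causal path is unshielded. -/
theorem ShorterCausal.not_adj_of_isCollider (hD : D.IsDAG) {l r : List V} {a b c : V}
    (hs : D.ShorterCausal X Y Z (l ++ a :: b :: c :: r).length)
    (hp : D.IsProperPath X Y (l ++ a :: b :: c :: r))
    (hconn : D.DConnecting Z (l ++ a :: b :: c :: r)) (hcol : D.IsCollider a b c) :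
    ¬ D.Adj a c := by
  intro hac
  obtain ⟨z, hz, hbz⟩ := hconn.openTriple.2 hcol
  obtain ⟨hab, hcb⟩ := hcol
  have haz := hbz.head hab
  have hcz := hbz.head hcb
  have h := hs.skip hp hconn hac
  simp only [hD.openTriple_iff] at h
  -- Where interior, `a` and `c` were non-colliders, so outside `Z`; should one become a collider,
  -- it is open as an ancestor of `z`.
  refine (h ?_ ?_).2.2.2 c (by simp) z hz hcz <;> grind

/-- The middle node of a shielded triple on a shortest open non-causal path is a fork. -/
theorem ShorterCausal.fork_of_adj (hD : D.IsDAG) {l r : List V} {a b c : V}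
    (hs : D.ShorterCausal X Y Z (l ++ a :: b :: c :: r).length)
    (hp : D.IsProperPath X Y (l ++ a :: b :: c :: r))
    (hconn : D.DConnecting Z (l ++ a :: b :: c :: r))
    (hnc : ¬ (l ++ a :: b :: c :: r).IsChain D.dir) (hac : D.Adj a c) :
    D.dir b a ∧ D.dir b c := by
  obtain ⟨-, -, -, -, h₅, hab, -⟩ := isProperPath_append_iff.1 hp
  have hbc := (List.isChain_cons_cons.1 h₅).1
  have h := hs.skip hp hconn hac
  simp only [hD.openTriple_iff] at h
  rcases hD.adj_iff.1 hab with hab | hba <;> rcases hD.adj_iff.1 hbc with hbc | hcb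
  -- The edge `a → c` has the same marks at `a` and `c` as the chain it replaces, so the shortcut is
  -- open and directed, and then so is the original path.
  · have hac' := hD.dir_of_adj_of_dir_dir hab hbc hac
    have := h (by grind [D.dir_asymm]) (by grind [D.dir_asymm])
    refine absurd ?_ hnc
    rw [List.isChain_append_cons_cons, List.isChain_cons_cons]
    exact ⟨this.1, hab, hbc, this.2.2.1⟩
  · exact absurd hac (hs.not_adj_of_isCollider hD hp hconn ⟨hab, hcb⟩)
  · exact ⟨hba, hbc⟩
  · have hca := hD.dir_of_adj_of_dir_dir hcb hba hac.symm
    have := h (by grind [D.dir_asymm]) (by grind [D.dir_asymm])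
    exact absurd this.2.1 (D.dir_asymm _ _ hca)

/-- A collider `d → a ← b` of a represented DAG is shielded if the graph has the edge `b - a`. -/
theorem Represents.adj_of_undir (h : G.Represents D) {d a b : V} (hda : D.dir d a)
    (hba : D.dir b a) (hab : G.undir b a) (hdb : d ≠ b) : D.Adj d b := by
  by_contra hn
  have := (h.2.1 d a b).1 ⟨hda, hba, hdb, hn⟩
  exact G.not_undir_of_dir _ _ this.2.1 hab

/-- The edge between `a` and `c` leaves the mark at its head unchanged and turns the arrowhead at
its tail into a tail. So skipping `b` can only fail to be open when that tail node is in `Z`; then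
it is a collider whose edge from `b` is undirected in `G`, hence shielded, and it can be skipped
instead. -/
theorem ShorterCausal.not_fork_of_undir (h : G.Represents D) (hD : D.IsDAG)
    (hYZ : Disjoint Y Z) (hamen : G.BAmenable X Y) {l r : List V} {a b c : V}
    (hs : D.ShorterCausal X Y Z (l ++ a :: b :: c :: r).length)
    (hp : D.IsProperPath X Y (l ++ a :: b :: c :: r))
    (hconn : D.DConnecting Z (l ++ a :: b :: c :: r)) (hac : D.Adj a c)
    (hab : G.undir b a) (hbc : G.undir b c) (hba' : D.dir b a) (hbc' : D.dir b c) : False := by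
  obtain ⟨-, -, hnodup, h₄, h₅, -, -⟩ := isProperPath_append_iff.1 hp
  have hopen := hconn.openTriple
  have hskip := hs.skip hp hconn hac
  simp only [hD.openTriple_iff] at hskip hopen
  have hbZ : b ∉ Z := hopen.1 (Or.inl hba')
  rcases hD.adj_iff.1 hac with hac' | hca'
  · rcases List.eq_nil_or_concat l with rfl | ⟨l, d, rfl⟩
    · -- the shortcut is causal, which makes `a - b - c` the start of a possibly causal path
      have hq := IsProperPath.shortcut (l := []) (m := [b]) (by simpa using hp) hac
      have hqc : D.DConnecting Z ([] ++ a :: c :: r) := by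
        refine (hconn.of_infix (q := b :: c :: r) ⟨[a], [], by simp⟩).change_head ?_
        simp only [hD.openTriple_iff]
        grind [D.dir_asymm]
      have hchain := (hs _ hq hqc (by simp) (by simp)).1
      have hcr : (c :: r).IsChain D.dir := (List.isChain_cons_cons.1 hchain).2
      have hpw₁ := hD.2.pairwise_not_dir_of_isChain_dir hchain
      have hpw₂ := hD.2.pairwise_not_dir_of_isChain_dir (List.isChain_cons_cons.2 ⟨hbc', hcr⟩)
      have hpc : G.BPossiblyCausal ([] ++ a :: b :: c :: r) := by
        refine ⟨by simp, List.pairwise_cons.2 ⟨?_, hpw₂.imp ?_⟩⟩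
        · intro v hv hva
          rcases List.mem_cons.1 hv with rfl | hv
          · exact G.not_undir_of_dir _ _ hva hab
          · exact (List.pairwise_cons.1 hpw₁).1 v hv (h.2.2 _ _ hva)
        · intro u v huv hvu
          exact huv (h.2.2 _ _ hvu)
      obtain ⟨a', b', l', heq, hdir⟩ := hamen _ (h.isProperPath_congr.1 hp) hpc
      simp only [List.nil_append, List.cons.injEq] at heq
      obtain ⟨rfl, rfl, -⟩ := heq
      exact G.not_undir_of_dir _ _ hdir (G.undir_symm _ _ hab)
    · have e : (l.concat d) ++ a :: b :: c :: r = l ++ d :: a :: b :: c :: r := by simp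
      rw [e] at hp hconn hs hnodup
      have hda : D.Adj d a := by
        have := (isProperPath_append_iff.1 hp).2.2.2.2.2.1
        exact this
      have hopen' := hconn.openTriple
      simp only [hD.openTriple_iff] at hopen'
      rcases hD.adj_iff.1 hda with hda | had
      · obtain ⟨z, hz, haz⟩ := hopen'.2 ⟨hda, hba'⟩
        -- If `a ∈ Z`, then `d` and `b` are adjacent parents of a node of `Z`, and `a` is skipped;
        -- otherwise `b` is skipped and the former collider `a` is still an ancestor of `Z`.
        by_cases haZ : a ∈ Z
        · have hdb : d ≠ b := by
            rintro rfl
            simp [List.nodup_append] at hnodup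
          have hda' : ∃ z ∈ Z, D.IsDescendant d z := ⟨a, haZ, Relation.ReflTransGen.single hda⟩
          have hba : D.IsDescendant b a := Relation.ReflTransGen.single hba'
          have hskip' := hs.skip hp hconn (h.adj_of_undir hda hba' hab hdb)
          simp only [hD.openTriple_iff] at hskip'
          exact (hskip' (by grind) (by grind)).2.2.2 b (by simp) a haZ hba
        · exact (hskip (by grind) (by grind [D.dir_asymm])).2.2.2 a (by cases l <;> simp) z hz haz
      · have haZ : a ∉ Z := hopen'.1 (Or.inl had)
        have := (hskip (by grind) (by grind [D.dir_asymm])).1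
        have hda : D.dir d a := by simpa using (List.isChain_append.1 this).2.2
        exact D.dir_asymm _ _ hda had
  -- The mirror case. Here `c ∈ Z` cannot be the last node, as `Y` and `Z` are disjoint. A directed
  -- shortcut would contradict `b → a` or `c → a`.
  · by_cases hcZ : c ∈ Z
    · rcases r with _ | ⟨f, r⟩
      · obtain ⟨y, hy, hyc⟩ := (isProperPath_append_iff.1 hp).2.1
        obtain rfl : c = y := by simpa using hyc
        exact hYZ.notMem_of_mem_left hy hcZ
      · have e : l ++ a :: b :: c :: f :: r = (l ++ [a]) ++ b :: c :: f :: r := by simp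
        rw [e] at hp hconn hs hnodup
        have hcf : D.Adj c f := by
          simp only [List.isChain_cons_cons] at h₅
          exact h₅.2.1
        have hopen' := DConnecting.openTriple hconn
        simp only [hD.openTriple_iff] at hopen'
        have hfc : D.dir f c :=
          (hD.adj_iff.1 hcf).resolve_left fun hcf => hopen'.1 (Or.inr hcf) hcZ
        have hfb : f ≠ b := by
          rintro rfl
          simp [List.nodup_append] at hnodup
        have hfz : ∃ z ∈ Z, D.IsDescendant f z := ⟨c, hcZ, Relation.ReflTransGen.single hfc⟩
        have hbz : ∃ z ∈ Z, D.IsDescendant b z := ⟨c, hcZ, Relation.ReflTransGen.single hbc'⟩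
        have hskip' := hs.skip hp hconn (h.adj_of_undir hfc hbc' hbc hfb).symm
        simp only [hD.openTriple_iff] at hskip'
        have := (hskip' (by grind) (by grind)).1
        have hab' : D.dir a b := by simpa using (List.isChain_append.1 this).2.2
        exact D.dir_asymm _ _ hab' hba'
    · have := hskip (by grind [D.dir_asymm]) (by grind)
      exact D.dir_asymm _ _ this.2.1 hca'

theorem IsMaximalPDAG.adj_of_dir_undir (hG : G.IsMaximalPDAG) {k i j : V} (hki : G.dir k i)
    (hij : G.undir i j) : G.Adj k j := by
  by_contra hn
  exact hG.2.1 i j k ⟨hij, hki, hn⟩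

theorem IsMaximalPDAG.adj_of_not_definiteStatus (hG : G.IsMaximalPDAG) {a b c : V}
    (hab : G.Adj a b) (hbc : G.Adj b c)
    (hs : ¬ (G.IsCollider a b c ∨ G.IsDefiniteNonCollider a b c)) :
    ¬ G.dir b a ∧ ¬ G.dir b c ∧ G.Adj a c := by
  simp only [IsCollider, IsDefiniteNonCollider, not_or] at hs
  obtain ⟨hcol, hba, hbc', hund⟩ := hs
  refine ⟨hba, hbc', ?_⟩
  rcases hab with hab | hab | hab
  · rcases hbc with hbc | hbc | hbc
    · exact absurd hbc hbc'
    · exact absurd ⟨hab, hbc⟩ hcol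
    · exact hG.adj_of_dir_undir hab hbc
  · exact absurd hab hba
  · rcases hbc with hbc | hbc | hbc
    · exact absurd hbc hbc'
    · exact (hG.adj_of_dir_undir hbc (G.undir_symm _ _ hab)).symm
    · exact not_not.1 fun hn => hund ⟨hab, hbc, hn⟩

/-- By R1 a triple without definite status is shielded, so by minimality it is a fork in `D`. Both
its edges are then undirected in `G`, which `ShorterCausal.not_fork_of_undir` excludes. -/
theorem ShorterCausal.definiteStatus (hG : G.IsMaximalPDAG) (h : G.Represents D) (hD : D.IsDAG)
    (hYZ : Disjoint Y Z) (hamen : G.BAmenable X Y) {p : List V}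
    (hs : D.ShorterCausal X Y Z p.length) (hp : D.IsProperPath X Y p)
    (hconn : D.DConnecting Z p) (hnc : ¬ p.IsChain D.dir) : G.DefiniteStatus p := by
  intro a b c habc
  obtain ⟨l, r, rfl⟩ := habc
  have e : l ++ [a, b, c] ++ r = l ++ a :: b :: c :: r := by simp
  rw [e] at hs hp hconn hnc
  by_contra hcon
  obtain ⟨-, -, -, -, h₅, hab, -⟩ := isProperPath_append_iff.1 hp
  have hbc := (h.1 _ _).1 (List.isChain_cons_cons.1 h₅).1
  rw [h.1] at hab
  obtain ⟨hnba, hnbc, hac⟩ := hG.adj_of_not_definiteStatus hab hbc hcon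
  have hac' := (h.1 _ _).2 hac
  obtain ⟨hba', hbc'⟩ := hs.fork_of_adj hD hp hconn hnc hac'
  have h₁ : ¬ G.dir a b := fun h' => D.dir_asymm _ _ hba' (h.2.2 _ _ h')
  have h₂ : ¬ G.dir c b := fun h' => D.dir_asymm _ _ hbc' (h.2.2 _ _ h')
  have hab' : G.undir b a :=
    G.undir_symm _ _ ((hab.resolve_left h₁).resolve_left hnba)
  have hbc'' : G.undir b c := (hbc.resolve_left hnbc).resolve_left h₂
  exact hs.not_fork_of_undir h hD hYZ hamen hp hconn hac' hab' hbc'' hba' hbc'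

/-! ### Descendants of colliders -/

/-- The number of nodes that can be reached from `v` by a directed path with an edge. -/
noncomputable def descendantCount (D : PartiallyDirectedGraph V) (v : V) : ℕ :=
  {w | Relation.TransGen D.dir v w}.ncard

theorem IsPDAG.descendantCount_lt [Finite V] (hD : D.IsPDAG) {v w : V} (h : D.dir v w) :
    D.descendantCount w < D.descendantCount v := by
  refine Set.ncard_lt_ncard ⟨fun u hu => Relation.TransGen.head h hu, fun hsub => ?_⟩
  exact hD w (hsub (Relation.TransGen.single h))

/-- The child of a collider is reached by a directed edge of the represented graph, if it has
descendants in `Z`, on a path that is shortest and cannot be moved downwards. -/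
theorem ShorterCausal.dir_of_isCollider [Finite V] (hG : G.IsMaximalPDAG) (h : G.Represents D)
    (hD : D.IsDAG) {p : List V}
    (hs : D.ShorterCausal X Y Z p.length) (hp : D.IsProperPath X Y p)
    (hconn : D.DConnecting Z p)
    (hmin : ∀ q, D.IsProperPath X Y q → D.DConnecting Z q → q.length = p.length →
      (q.map D.descendantCount).sum < (p.map D.descendantCount).sum → q.IsChain D.dir)
    {a b c w z : V} (habc : [a, b, c] <:+: p) (hcol : G.IsCollider a b c) (hbw : D.dir b w)
    (hz : z ∈ Z) (hwz : D.IsDescendant w z) : G.dir b w := by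
  obtain ⟨l, r, rfl⟩ := habc
  have e : l ++ [a, b, c] ++ r = l ++ a :: b :: c :: r := by simp
  rw [e] at hs hp hconn hmin
  by_contra hn
  have hundir : G.undir b w := by
    rcases (h.1 _ _).1 (Or.inl hbw) with h' | h' | h'
    · exact absurd h' hn
    · exact absurd (h.2.2 _ _ h') (D.dir_asymm _ _ hbw)
    · exact h'
  have hab := h.2.2 _ _ hcol.1
  have hcb := h.2.2 _ _ hcol.2
  -- R1 makes `w` adjacent to `a` and `c`, and acyclicity gives `a → w ← c` in `D`, so `w` can take
  -- over the role of `b`.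
  have hawA : D.Adj a w := (h.1 _ _).2 (hG.adj_of_dir_undir hcol.1 hundir)
  have hcwA : D.Adj c w := (h.1 _ _).2 (hG.adj_of_dir_undir hcol.2 hundir)
  have haw := hD.dir_of_adj_of_dir_dir hab hbw hawA
  have hcw := hD.dir_of_adj_of_dir_dir hcb hbw hcwA
  have hwZ : ∃ z ∈ Z, D.IsDescendant w z := ⟨z, hz, hwz⟩
  have hcr : D.DConnecting Z (w :: c :: r) := by
    refine (hconn.of_infix (q := b :: c :: r) ⟨l ++ [a], [], by simp⟩).change_head ?_
    simp only [hD.openTriple_iff]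
    grind [D.dir_asymm]
  have hla : D.DConnecting Z (l ++ [a, w]) := by
    refine (hconn.of_infix (q := l ++ [a, b]) ⟨[], c :: r, by simp⟩).change_last ?_
    simp only [hD.openTriple_iff]
    grind [D.dir_asymm]
  -- If `w` is already on the path, or is in `X`, the new edges give a shorter open path. Otherwise
  -- replacing `b` by `w` keeps the length and lowers the descendant sum.
  by_cases hwp : w ∈ l ++ a :: b :: c :: r
  · simp only [List.mem_append, List.mem_cons] at hwp
    rcases hwp with hwl | rfl | rfl | rfl | hwr
    · obtain ⟨l, m, rfl⟩ := List.append_of_mem hwl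
      obtain ⟨e, t, ht⟩ : ∃ e t, m ++ a :: b :: c :: r = e :: t :=
        List.exists_cons_of_ne_nil (by simp)
      have e₁ : (l ++ w :: m) ++ a :: b :: c :: r = l ++ w :: e :: t := by simp [ht]
      rw [e₁] at hs hp hconn
      have := hs.shortcut (s := m ++ [a]) (e := b) (c := c) (r := r) hp hconn (by simp [← ht])
        hcwA.symm (by simp only [hD.openTriple_iff]; grind [D.dir_asymm])
        (by simp only [hD.openTriple_iff]; grind [D.dir_asymm])
      exact D.dir_asymm _ _ hcw this.2.1
    · exact D.dir_asymm _ _ hab hbw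
    · exact hD.2 _ (Relation.TransGen.single hbw)
    · exact D.dir_asymm _ _ hcb hbw
    · obtain ⟨m, r, rfl⟩ := List.append_of_mem hwr
      obtain ⟨s, e, hse⟩ : ∃ s e, b :: c :: m = s ++ [e] := by
        rcases List.eq_nil_or_concat (b :: c :: m) with h' | ⟨s, e, h'⟩
        · simp at h'
        · exact ⟨s, e, by simpa using h'⟩
      have := hs.shortcut (s := s) (e := e) (c := w) (r := r) hp hconn
        (by
          have : b :: c :: (m ++ w :: r) = (b :: c :: m) ++ w :: r := by simp
          rw [this, hse]
          simp)
        hawA (by simp only [hD.openTriple_iff]; grind [D.dir_asymm])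
        (by simp only [hD.openTriple_iff]; grind [D.dir_asymm])
      exact this.2.2.2 w (by simp) z hz hwz
  · by_cases hwX : w ∈ X
    · have hq : D.IsProperPath X Y (w :: c :: r) :=
        IsProperPath.restart (l := l ++ [a]) (a := b) (by simpa using hp) hwX hcwA.symm
      have := (hs _ hq hcr (by simp) (by simp; omega)).1
      exact D.dir_asymm _ _ hcw (List.isChain_cons_cons.1 this).1
    · have hq := hp.replace hwX hwp hawA hcwA.symm
      have hqc : D.DConnecting Z (l ++ a :: w :: c :: r) := by
        rw [dConnecting_split]
        refine ⟨hla, ?_⟩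
        have : D.DConnecting Z ([a] ++ w :: c :: r) := by
          rw [dConnecting_split]
          refine ⟨?_, hcr⟩
          intro x y u hx
          have := hx.eq_of_length (by simp)
          simp only [List.singleton_append, List.cons.injEq, and_true] at this
          obtain ⟨rfl, rfl, rfl⟩ := this
          exact hD.openTriple_iff.2 (by grind [D.dir_asymm])
        exact this
      have := hmin _ hq hqc (by simp) (by
        have := hD.2.descendantCount_lt hbw
        simp
        omega)
      rw [List.isChain_append_cons_cons, List.isChain_cons_cons] at this
      exact D.dir_asymm _ _ hcw this.2.2.1

/-- If `u - w` is undirected in `G`, R1 makes the parent of `u` adjacent to `w`, and acyclicity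
orients that edge towards `w` in `D`. Repeating this climbs back towards `v`. -/
theorem Represents.isDescendant_or_dir (hG : G.IsMaximalPDAG) (h : G.Represents D) (hD : D.IsDAG)
    {v u : V} (hvu : G.IsDescendant v u) {w : V} (huw : D.dir u w) :
    G.IsDescendant v w ∨ D.dir v w := by
  unfold IsDescendant at *
  induction hvu generalizing w with
  | refl => exact Or.inr huw
  | @tail t u hvt htu ih =>
    rcases (h.1 _ _).1 (Or.inl huw) with h' | h' | h'
    · exact Or.inl ((hvt.tail htu).tail h')
    · exact absurd (h.2.2 _ _ h') (D.dir_asymm _ _ huw)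
    · exact ih (hD.dir_of_adj_of_dir_dir (h.2.2 _ _ htu) huw
        ((h.1 _ _).2 (hG.adj_of_dir_undir htu h')))

/-- Following a directed path of `D` to `z`, each node remains a descendant of `v` in `G`: if the
step itself gives no directed path of `G`, there is an edge `v → w` of `D`, to which `hv` applies.
-/
theorem Represents.exists_isDescendant (hG : G.IsMaximalPDAG) (h : G.Represents D) (hD : D.IsDAG)
    {v : V} (hv : ∀ w, D.dir v w → (∃ z ∈ Z, D.IsDescendant w z) → G.dir v w)
    {z : V} (hz : z ∈ Z) (hvz : D.IsDescendant v z) : G.IsDescendant v z := by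
  have key : ∀ u, D.IsDescendant u z → G.IsDescendant v u → G.IsDescendant v z := by
    intro u hu
    induction hu using Relation.ReflTransGen.head_induction_on with
    | refl => exact id
    | @head u w huw hwz ih =>
      intro hvu
      rcases h.isDescendant_or_dir hG hD hvu huw with hvw | hvw
      · exact ih hvw
      · exact ih (Relation.ReflTransGen.single (hv w hvw ⟨z, hz, hwz⟩))
  exact key v hvz Relation.ReflTransGen.refl

/-! ### The blocking condition in represented DAGs -/

theorem Represents.bBlockingCondition_of_bBlockingCondition [Finite V] (hG : G.IsMaximalPDAG)
    (h : G.Represents D) (hD : D.IsDAG) (hYZ : Disjoint Y Z) (hamen : G.BAmenable X Y)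
    (hforb : G.BForbiddenSetCondition X Y Z) (hb : G.BBlockingCondition X Y Z) :
    D.BBlockingCondition X Y Z := by
  by_contra hcon
  let S : Set (List V) :=
    {p | D.IsProperPath X Y p ∧ D.DConnecting Z p ∧ 2 ≤ p.length ∧ ¬ p.IsChain D.dir}
  have hS : S.Nonempty := by
    simp only [BBlockingCondition, Blocked, not_forall, not_not] at hcon
    obtain ⟨p, hp, hnc, -, hconn⟩ := hcon
    exact ⟨p, hp, hconn, (hD.bNonCausal_iff (isProperPath_iff.1 hp).2.2.2.1).1 hnc⟩
  -- Length comes first because a shortcut may be taken whatever it does to the sum; the sum decides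
  -- only between paths of equal length.
  let f : List V → ℕ ×ₗ ℕ := fun p => toLex (p.length, (p.map D.descendantCount).sum)
  obtain ⟨p, ⟨hp, hconn, h2, hnc⟩, hmin⟩ := (InvImage.wf f wellFounded_lt).has_min S hS
  have hmin' : ∀ q, D.IsProperPath X Y q → D.DConnecting Z q → 2 ≤ q.length → f q < f p →
      q.IsChain D.dir := by
    intro q hq hqc hq2 hlt
    by_contra hn
    exact hmin q ⟨hq, hqc, hq2, hn⟩ hlt
  have hs : D.ShorterCausal X Y Z p.length := by
    intro q hq hqc hq2 hlt
    have hchain := hmin' q hq hqc hq2 (Prod.Lex.toLex_lt_toLex.2 (Or.inl hlt))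
    exact ⟨hchain, fun v hv z hz => h.not_isDescendant_of_bPossiblyCausal hD hforb hq
      (h.bPossiblyCausal_of_isChain_dir hD hq2 hchain) hv hz⟩
  have hds := hs.definiteStatus hG h hD hYZ hamen hp hconn hnc
  obtain ⟨-, -, hnodup, hadj, -⟩ := isProperPath_iff.1 hp
  have hncG := h.bNonCausal hD hamen hforb hp ((hD.bNonCausal_iff hadj).2 ⟨h2, hnc⟩) hconn
  refine hb p (h.isProperPath_congr.1 hp) hncG hds ?_
  intro a b c habc
  obtain ⟨hcol, hexcl⟩ := h.isCollider_iff (ne_of_triple_infix hnodup habc) (hds a b c habc)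
  have hopen := hconn a b c habc
  constructor
  · intro hn
    have hncol : ¬ D.IsCollider a b c := fun hc => hexcl (hcol.1 hc) hn
    have := hD.definiteStatus_of_isChain hadj a b c habc
    exact hopen.1 (this.resolve_left hncol)
  · intro hc
    obtain ⟨z, hz, hbz⟩ := hopen.2 (hcol.2 hc)
    refine ⟨z, hz, h.exists_isDescendant hG hD ?_ hz hbz⟩
    rintro w hbw ⟨z', hz', hwz'⟩
    refine hs.dir_of_isCollider hG h hD hp hconn ?_ habc hc hbw hz' hwz'
    intro q hq hqc hlen hsum
    exact hmin' q hq hqc (hlen ▸ h2) (Prod.Lex.toLex_lt_toLex.2 (Or.inr ⟨hlen, hsum⟩))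

end PartiallyDirectedGraph

theorem mainTheorem6 {V : Type*} [Finite V] (G : PartiallyDirectedGraph V)
    (hG : G.IsMaximalPDAG)
    (hDAG : ∃ D ∈ G.representedClass, D.IsDAG)
    (X Y Z : Set V) (hXY : Disjoint X Y) (hXZ : Disjoint X Z) (hYZ : Disjoint Y Z)
    (hamen : G.BAmenable X Y) (hforb : G.BForbiddenSetCondition X Y Z) :
    List.TFAE
      [G.BBlockingCondition X Y Z,
       ∀ D ∈ G.representedClass, D.IsDAG → D.BBlockingCondition X Y Z,
       ∃ D ∈ G.representedClass, D.IsDAG ∧ D.BBlockingCondition X Y Z] := by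
  tfae_have 1 → 2 := fun h D hD hdag =>
    hD.2.bBlockingCondition_of_bBlockingCondition hG hdag hYZ hamen hforb h
  tfae_have 2 → 3 := fun h => by
    obtain ⟨D, hD, hdag⟩ := hDAG
    exact ⟨D, hD, hdag, h D hD hdag⟩
  tfae_have 3 → 1 := fun ⟨D, hD, hdag, h⟩ => hD.2.bBlockingCondition hdag h
  tfae_finish
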